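/- Let $\mathbf{k}$ be a field of characteristic $0$ and $\Omega$ a nonempty set; all algebras are commutative unital $\mathbf{k}$-algebras and $\otimes=\otimes_{\mathbf{k}}$. **Definitions.** An $\Omega$-MTRBA (matching twisted Rota–Baxter algebra, of weight zero) is an algebra $R$ with linear operators $P_\omega:R\to R$ and invertible elements $a_\omega\in R$ ($\omega\in\Omega$) such that $$P_\alpha(x)P_\beta(y)=a_\alpha P_\beta\big(a_\alpha^{-1}P_\alpha(x)y\big)+a_\beta P_\alpha\big(a_\beta^{-1}xP_\beta(y)\big)\qquad(x,y\in R,\ \alpha,\beta\in\Omega);$$ when all $a_\omega=1$, $(R,P_\Omega)$ is called an $\Omega$-MRBA. Homomorphisms are algebra homomorphisms commuting with the operators and preserving the twists. Given an $\Omega$-MTRBA $(A,\rho_\Omega,a_\Omega)$, an $(A,\rho_\Omega,a_\Omega)$-MTRBA is an $\Omega$-MTRBA $R$ with an $\Omega$-MTRBA homomorphism $j_R:A\to R$, and a homomorphism of such is an $\Omega$-MTRBA homomorphism compatible with the structure maps. The free $(A,\rho_\Omega,a_\Omega)$-MTRBA over an algebra $B$ is an $(A,\rho_\Omega,a_\Omega)$-MTRBA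 $F$ with an algebra homomorphism $i_B:B\to F$ such that, for every $(A,\rho_\Omega,a_\Omega)$-MTRBA $R$ and algebra homomorphism $f:B\to R$, there is a unique homomorphism $\bar f:F\to R$ of $(A,\rho_\Omega,a_\Omega)$-MTRBAs with $f=\bar f\, i_B$. Free $(A,\phi_\Omega)$-MRBAs over $B$, for an $\Omega$-MRBA $(A,\phi_\Omega)$, are defined in the same way without twists. For a linear operator $Q$ on an algebra and an invertible element $a$, put $Q^{a}(r)=aQ(a^{-1}r)$. **Construction.** Let $(A,\rho_\Omega,a_\Omega)$ be an $\Omega$-MTRBA and $B=\mathbf{k}\oplus B^+$ an augmented algebra, where $B^+$ is the kernel of the augmentation. Put $\mathfrak A=A\otimes B$ and $\mathfrak A^+=A\otimes B^+$, so that $\mathfrak A=A\oplus\mathfrak A^+$, and $$\mathrm{Sh}(A,B)=\bigoplus_{k\ge 0}\mathfrak A\otimes(\mathbf{k}\Omega\otimes\mathfrak A^+)^{\otimes k}.$$ Let $\phi_\omega=\rho_\omega^{a_\omega^{-1}}$, that is, $\phi_\omega(x)=a_\omega^{-1}\rho_\omega(a_\omega x)$. Let $P_{F,\omega}$ be the linear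 operator on $\mathrm{Sh}(A,B)$ given on $u=u_0\otimes(\omega_1\otimes u_1)\otimes\cdots\otimes(\omega_n\otimes u_n)$, with $u_i\in\mathfrak A^+$ for $i\ge1$, by $$P_{F,\omega}(u)=\begin{cases}\phi_\omega(u_0), & u_0\in A,\ n=0,\\ \phi_\omega(u_0)\otimes(\omega_1\otimes u_1)\otimes\cdots\otimes(\omega_n\otimes u_n)\\ \quad-1\otimes(\omega_1\otimes\phi_\omega(u_0)u_1)\otimes(\omega_2\otimes u_2)\otimes\cdots\otimes(\omega_n\otimes u_n), & u_0\in A,\ n>0,\\ 1\otimes(\omega\otimes u_0)\otimes(\omega_1\otimes u_1)\otimes\cdots\otimes(\omega_n\otimes u_n), & u_0\in\mathfrak A^+.\end{cases}$$ For $u=u_0\otimes(\omega_1\otimes u_1)\otimes\cdots\otimes(\omega_m\otimes u_m)$ with $m>0$ put $u'=u_1\otimes(\omega_2\otimes u_2)\otimes\cdots\otimes(\omega_m\otimes u_m)$; likewise, for $v=v_0\otimes(\varepsilon_1\otimes v_1)\otimes\cdots\otimes(\varepsilon_n\otimes v_n)$ with $n>0$, put $v'=v_1\otimes(\varepsilon_2\otimes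 v_2)\otimes\cdots\otimes(\varepsilon_n\otimes v_n)$. Let $\diamond$ be the bilinear product on $\mathrm{Sh}(A,B)$ with $$u\diamond v=\begin{cases}u_0v_0\otimes(\varepsilon_1\otimes v_1)\otimes\cdots\otimes(\varepsilon_n\otimes v_n), & m=0,\\ u_0v_0\otimes(\omega_1\otimes u_1)\otimes\cdots\otimes(\omega_m\otimes u_m), & n=0,\\ u_0v_0\,P_{F,\varepsilon_1}\big(P_{F,\omega_1}(u')\diamond v'\big)+u_0v_0\,P_{F,\omega_1}\big(u'\diamond P_{F,\varepsilon_1}(v')\big), & m,n>0.\end{cases}$$ This is a commutative unital algebra. Let $j_F:A\to\mathrm{Sh}(A,B)$ and $i_B:B\to\mathrm{Sh}(A,B)$ be the natural inclusions, put $a_{F,\omega}=j_F(a_\omega)$, and consider the conjugated operators $P_{F,\omega}^{a_{F,\omega}}$. **Theorem.** 1. $\big((\mathrm{Sh}(A,B),\diamond),\,P_{F,\Omega}^{a_{F,\Omega}},\,a_{F,\Omega},\,j_F,\,i_B\big)$ is the free $(A,\rho_\Omega,a_\Omega)$-MTRBA over $B$. 2. For $u=u_0\otimes(\omega_1\otimes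 u_1)\otimes\cdots\otimes(\omega_n\otimes u_n)$ as above, $$P_{F,\omega}^{a_{F,\omega}}(u)=\begin{cases}\rho_\omega(u_0), & u_0\in A,\ n=0,\\ \rho_\omega(u_0)\otimes(\omega_1\otimes u_1)\otimes\cdots\otimes(\omega_n\otimes u_n)\\ \quad-a_\omega\otimes(\omega_1\otimes a_\omega^{-1}\rho_\omega(u_0)u_1)\otimes(\omega_2\otimes u_2)\otimes\cdots\otimes(\omega_n\otimes u_n), & u_0\in A,\ n>0,\\ a_\omega\otimes(\omega\otimes a_\omega^{-1}u_0)\otimes(\omega_1\otimes u_1)\otimes\cdots\otimes(\omega_n\otimes u_n), & u_0\in\mathfrak A^+.\end{cases}$$ 3. $(A,\phi_\Omega)$ is an $\Omega$-MRBA, and $\big((\mathrm{Sh}(A,B),\diamond),\,P_{F,\Omega},\,j_F,\,i_B\big)$ is the free $(A,\phi_\Omega)$-MRBA over $B$. -/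

import Mathlib

open scoped TensorProduct DirectSum

set_option maxSynthPendingDepth 3

universe w

noncomputable section

namespace MTRBA

/-! ### Matching Rota-Baxter algebras and matching twisted Rota-Baxter algebras (weight zero) -/

section Structures

variable {k Ω A B R S F : Type*} [CommRing k]
  [CommRing A] [Algebra k A] [CommRing B] [Algebra k B] [CommRing R] [Algebra k R]
  [CommRing S] [Algebra k S] [CommRing F] [Algebra k F]

/-- For an invertible element `a` of `R` and a linear operator `Q` on `R`, the operator
`Q^a : r ↦ a * Q (a⁻¹ * r)`. -/
def twistOp (a : Rˣ) (Q : R →ₗ[k] R) : R →ₗ[k] R :=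
  LinearMap.mulLeft k (a : R) ∘ₗ Q ∘ₗ LinearMap.mulLeft k ((a⁻¹ : Rˣ) : R)

/-- `(R, P_Ω)` is an `Ω`-matching Rota-Baxter algebra (of weight zero). -/
def IsMRBA (P : Ω → R →ₗ[k] R) : Prop :=
  ∀ (α β : Ω) (x y : R), P α x * P β y = P α (x * P β y) + P β (P α x * y)

/-- `(R, P_Ω, a_Ω)` is an `Ω`-matching twisted Rota-Baxter algebra (of weight zero) with
twist `a_Ω`. -/
def IsMTRBA (P : Ω → R →ₗ[k] R) (a : Ω → Rˣ) : Prop :=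
  ∀ (α β : Ω) (x y : R), P α x * P β y =
    (a α : R) * P β (((a α)⁻¹ : Rˣ) * (P α x * y)) + (a β : R) * P α (((a β)⁻¹ : Rˣ) * (x * P β y))

/-- A homomorphism of `Ω`-MRBAs: an algebra homomorphism commuting with the operators. -/
def IsMRBAHom (P : Ω → R →ₗ[k] R) (Q : Ω → S →ₗ[k] S) (f : R →ₐ[k] S) : Prop :=
  ∀ (ω : Ω) (x : R), f (P ω x) = Q ω (f x)

/-- A homomorphism of `Ω`-MTRBAs: an algebra homomorphism preserving the twists and commuting
with the operators. -/
structure IsMTRBAHom (P : Ω → R →ₗ[k] R) (a : Ω → Rˣ) (Q : Ω → S →ₗ[k] S) (b : Ω → Sˣ)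
    (f : R →ₐ[k] S) : Prop where
  map_twist : ∀ ω : Ω, f (a ω : R) = (b ω : S)
  map_op : ∀ (ω : Ω) (x : R), f (P ω x) = Q ω (f x)

/-- `(R, P_Ω, j)` is an `(A, φ_Ω)`-MRBA with structure map `j : A → R`. -/
structure IsRelMRBA (φ : Ω → A →ₗ[k] A) (P : Ω → R →ₗ[k] R) (j : A →ₐ[k] R) : Prop where
  isMRBA : IsMRBA P
  isHom : IsMRBAHom φ P j

/-- `(R, P_Ω, a_{R,Ω}, j)` is an `(A, ρ_Ω, a_Ω)`-MTRBA with structure map `j : A → R`. -/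
structure IsRelMTRBA (ρ : Ω → A →ₗ[k] A) (a : Ω → Aˣ) (P : Ω → R →ₗ[k] R) (aR : Ω → Rˣ)
    (j : A →ₐ[k] R) : Prop where
  isMTRBA : IsMTRBA P aR
  isHom : IsMTRBAHom ρ a P aR j

/-- `(F, P_Ω, j, i)` is the free `(A, φ_Ω)`-MRBA over the algebra `B`; the universal
property is tested on algebras in the universe `w`. -/
structure IsFreeMRBA (φ : Ω → A →ₗ[k] A) (P : Ω → F →ₗ[k] F) (j : A →ₐ[k] F) (i : B →ₐ[k] F) :
    Prop where
  isRel : IsRelMRBA φ P j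
  universal : ∀ (R : Type w) [CommRing R] [Algebra k R] (Q : Ω → R →ₗ[k] R) (jR : A →ₐ[k] R),
    IsRelMRBA φ Q jR → ∀ f : B →ₐ[k] R,
      ∃! g : F →ₐ[k] R, IsMRBAHom P Q g ∧ jR = g.comp j ∧ f = g.comp i

/-- `(F, P_Ω, a_{F,Ω}, j, i)` is the free `(A, ρ_Ω, a_Ω)`-MTRBA over the algebra `B`; the
universal property is tested on algebras in the universe `w`. -/
structure IsFreeMTRBA (ρ : Ω → A →ₗ[k] A) (a : Ω → Aˣ) (P : Ω → F →ₗ[k] F) (aF : Ω → Fˣ)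
    (j : A →ₐ[k] F) (i : B →ₐ[k] F) : Prop where
  isRel : IsRelMTRBA ρ a P aF j
  universal : ∀ (R : Type w) [CommRing R] [Algebra k R] (Q : Ω → R →ₗ[k] R) (aR : Ω → Rˣ)
    (jR : A →ₐ[k] R), IsRelMTRBA ρ a Q aR jR → ∀ f : B →ₐ[k] R,
      ∃! g : F →ₐ[k] R, IsMTRBAHom P aF Q aR g ∧ jR = g.comp j ∧ f = g.comp i

end Structures

/-! ### The shuffle product on the tensor module `T(M) = ⨁ₙ M^{⊗ n}` -/

section Shuffle

variable (k M : Type*) [CommRing k] [AddCommMonoid M] [Module k M]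

variable {k M} in
/-- Prepending a letter: `m ↦ (v ↦ m ⊗ v)` on `T(M)`. -/
def cons : M →ₗ[k] TensorAlgebra k M →ₗ[k] TensorAlgebra k M :=
  LinearMap.mul k (TensorAlgebra k M) ∘ₗ TensorAlgebra.ι k

variable {k M} in
theorem cons_apply (m : M) (v : TensorAlgebra k M) : cons m v = TensorAlgebra.ι k m * v := rfl

variable {k M} in
theorem cons_induction {C : TensorAlgebra k M → Prop} (one : C 1)
    (cons_mem : ∀ m v, C v → C (cons m v)) (add : ∀ v w, C v → C w → C (v + w))
    (smul : ∀ (r : k) v, C v → C (r • v)) (v : TensorAlgebra k M) : C v := by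
  suffices h : ∀ w, C w → C (v * w) by simpa using h 1 one
  induction v using TensorAlgebra.induction with
  | algebraMap r => intro w hw; rw [← Algebra.smul_def]; exact smul r w hw
  | ι m => intro w hw; exact cons_mem m w hw
  | mul a b ha hb => intro w hw; rw [mul_assoc]; exact ha _ (hb _ hw)
  | add a b ha hb => intro w hw; rw [add_mul]; exact add _ _ (ha _ hw) (hb _ hw)

section Recursor

variable {k M} {X : Type*} [AddCommGroup X] [Module k X]
  (x₀ : X) (f : M →ₗ[k] TensorAlgebra k M →ₗ[k] X) (g : M →ₗ[k] X →ₗ[k] X)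

/-- One step of the recursion `tensorRec`, on pairs (word, value). -/
def tensorRecStep : M →ₗ[k] Module.End k (TensorAlgebra k M × X) where
  toFun m := ((cons m) ∘ₗ LinearMap.fst k _ _).prod
    (f m ∘ₗ LinearMap.fst k _ _ + g m ∘ₗ LinearMap.snd k _ _)
  map_add' m n := by
    ext <;> simp
  map_smul' r m := by
    ext <;> simp

/-- The linear map `h : T(M) → X` defined by recursion on words:
`h 1 = x₀` and `h (m ⊗ v) = f m v + g m (h v)`. -/
def tensorRec : TensorAlgebra k M →ₗ[k] X :=
  LinearMap.snd k (TensorAlgebra k M) X ∘ₗ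
    LinearMap.applyₗ ((1 : TensorAlgebra k M), x₀) ∘ₗ
      (TensorAlgebra.lift k (tensorRecStep f g)).toLinearMap

theorem tensorRec_one : tensorRec x₀ f g 1 = x₀ := by simp [tensorRec]

theorem tensorRecStep_apply (m : M) (p : TensorAlgebra k M × X) :
    tensorRecStep f g m p = (cons m p.1, f m p.1 + g m p.2) := rfl

theorem tensorRec_cons (m : M) (v : TensorAlgebra k M) :
    tensorRec x₀ f g (cons m v) = f m v + g m (tensorRec x₀ f g v) := by
  have key : ∀ v : TensorAlgebra k M,
      (TensorAlgebra.lift k (tensorRecStep f g) v ((1 : TensorAlgebra k M), x₀)).1 = v := by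
    intro v
    induction v using cons_induction with
    | one => simp
    | cons_mem m v hv => simp [cons_apply, tensorRecStep_apply, hv]
    | add v w hv hw => simp [hv, hw]
    | smul r v hv => simp [hv]
  simp [tensorRec, cons_apply, tensorRecStep_apply, key]

end Recursor

variable {k M}

/-- From the operator `ℓ = (w ↦ v ⧢ w)`, the operator `w ↦ (m ⊗ v) ⧢ w`, by recursion on `w`:
it sends `1` to `m ⊗ ℓ 1` and `n ⊗ w` to `m ⊗ ℓ (n ⊗ w) + n ⊗ ((m ⊗ v) ⧢ w)`. -/
def shuffleStep (m : M) (ℓ : Module.End k (TensorAlgebra k M)) :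
    Module.End k (TensorAlgebra k M) :=
  tensorRec (cons m (ℓ 1)) (cons.compr₂ (cons m ∘ₗ ℓ)) cons

theorem shuffleStep_one (m : M) (ℓ : Module.End k (TensorAlgebra k M)) :
    shuffleStep m ℓ 1 = cons m (ℓ 1) := tensorRec_one _ _ _

theorem shuffleStep_cons (m n : M) (ℓ : Module.End k (TensorAlgebra k M))
    (w : TensorAlgebra k M) :
    shuffleStep m ℓ (cons n w) = cons m (ℓ (cons n w)) + cons n (shuffleStep m ℓ w) :=
  tensorRec_cons _ _ _ _ _

/-- `shuffleStep` as a bilinear map. -/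
def shuffleStepₗ : M →ₗ[k] Module.End k (Module.End k (TensorAlgebra k M)) :=
  LinearMap.mk₂ k shuffleStep
    (by
      intro m m' ℓ; ext w
      induction w using cons_induction with
      | one => simp [shuffleStep_one]
      | cons_mem n w h =>
        simp only [shuffleStep_cons, LinearMap.add_apply, map_add] at h ⊢; rw [h, map_add]; abel
      | add v w hv hw => rw [map_add, map_add, hv, hw]
      | smul r v hv => rw [map_smul, map_smul, hv])
    (by
      intro r m ℓ; ext w
      induction w using cons_induction with
      | one => simp [shuffleStep_one]
      | cons_mem n w h =>
        simp only [shuffleStep_cons, LinearMap.smul_apply, map_smul] at h ⊢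
        rw [h, map_smul, smul_add]
      | add v w hv hw => rw [map_add, map_add, hv, hw]
      | smul r v hv => rw [map_smul, map_smul, hv])
    (by
      intro m ℓ ℓ'; ext w
      induction w using cons_induction with
      | one => simp [shuffleStep_one]
      | cons_mem n w h =>
        simp only [shuffleStep_cons, LinearMap.add_apply, map_add] at h ⊢; rw [h, map_add]; abel
      | add v w hv hw => rw [map_add, map_add, hv, hw]
      | smul r v hv => rw [map_smul, map_smul, hv])
    (by
      intro r m ℓ; ext w
      induction w using cons_induction with
      | one => simp [shuffleStep_one]
      | cons_mem n w h =>
        simp only [shuffleStep_cons, LinearMap.smul_apply, map_smul] at h ⊢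
        rw [h, map_smul, smul_add]
      | add v w hv hw => rw [map_add, map_add, hv, hw]
      | smul r v hv => rw [map_smul, map_smul, hv])

/-- The shuffle product on `T(M)` as a bilinear map. It is determined by `1 ⧢ w = w`,
`v ⧢ 1 = v` and `(m ⊗ v) ⧢ (n ⊗ w) = m ⊗ (v ⧢ (n ⊗ w)) + n ⊗ ((m ⊗ v) ⧢ w)`. -/
def shuffle : TensorAlgebra k M →ₗ[k] TensorAlgebra k M →ₗ[k] TensorAlgebra k M :=
  LinearMap.applyₗ (LinearMap.id : Module.End k (TensorAlgebra k M)) ∘ₗ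
    (TensorAlgebra.lift k (shuffleStepₗ (k := k) (M := M))).toLinearMap

theorem shuffle_one_left (w : TensorAlgebra k M) : shuffle 1 w = w := by simp [shuffle]

theorem shuffle_cons_left (m : M) (v : TensorAlgebra k M) :
    shuffle (cons m v) = shuffleStep m (shuffle v) := by
  simp [shuffle, cons_apply, shuffleStepₗ]

theorem shuffle_one_right (v : TensorAlgebra k M) : shuffle v 1 = v := by
  induction v using cons_induction with
  | one => exact shuffle_one_left 1
  | cons_mem m v h => rw [shuffle_cons_left, shuffleStep_one, h]
  | add v w hv hw => rw [map_add, LinearMap.add_apply, hv, hw]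
  | smul r v hv => rw [map_smul, LinearMap.smul_apply, hv]

theorem shuffle_cons_cons (m n : M) (v w : TensorAlgebra k M) :
    shuffle (cons m v) (cons n w) =
      cons m (shuffle v (cons n w)) + cons n (shuffle (cons m v) w) := by
  simp only [shuffle_cons_left, shuffleStep_cons]

theorem shuffle_comm (v w : TensorAlgebra k M) : shuffle v w = shuffle w v := by
  induction v using cons_induction generalizing w with
  | one => rw [shuffle_one_left, shuffle_one_right]
  | cons_mem m v hv =>
    induction w using cons_induction with
    | one => rw [shuffle_one_left, shuffle_one_right]
    | cons_mem n w hw => rw [shuffle_cons_cons, shuffle_cons_cons, hv, hw, add_comm]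
    | add x y hx hy => simp only [map_add, LinearMap.add_apply, hx, hy]
    | smul r x hx => simp only [map_smul, LinearMap.smul_apply, hx]
  | add x y hx hy => simp only [map_add, LinearMap.add_apply, hx, hy]
  | smul r x hx => simp only [map_smul, LinearMap.smul_apply, hx]

theorem shuffle_assoc (u v w : TensorAlgebra k M) :
    shuffle (shuffle u v) w = shuffle u (shuffle v w) := by
  induction u using cons_induction generalizing v w with
  | one => simp only [shuffle_one_left]
  | cons_mem a u hu =>
    induction v using cons_induction generalizing w with
    | one => simp only [shuffle_one_left, shuffle_one_right]
    | cons_mem b v hv =>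
      induction w using cons_induction with
      | one => simp only [shuffle_one_right]
      | cons_mem c w hw =>
        have e := congrArg (cons c) hw
        simp only [shuffle_cons_cons, map_add, LinearMap.add_apply, hu, hv] at e ⊢
        rw [← e]; abel
      | add x y hx hy => simp only [map_add, hx, hy]
      | smul r x hx => simp only [map_smul, hx]
    | add x y hx hy => simp only [map_add, LinearMap.add_apply, hx, hy]
    | smul r x hx => simp only [map_smul, LinearMap.smul_apply, hx]
  | add x y hx hy => simp only [map_add, LinearMap.add_apply, hx, hy]
  | smul r x hx => simp only [map_smul, LinearMap.smul_apply, hx]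

variable (k M)

/-- The module `T(M) = ⨁ₙ M^{⊗ n}`, to be equipped with the shuffle product. -/
def ShuffleAlgebra : Type _ := TensorAlgebra k M

instance : AddCommGroup (ShuffleAlgebra k M) := inferInstanceAs (AddCommGroup (TensorAlgebra k M))

instance : Module k (ShuffleAlgebra k M) := inferInstanceAs (Module k (TensorAlgebra k M))

instance : CommRing (ShuffleAlgebra k M) :=
  { (inferInstance : AddCommGroup (ShuffleAlgebra k M)) with
    mul := fun v w => shuffle (k := k) (M := M) v w
    one := (1 : TensorAlgebra k M)
    one_mul := shuffle_one_left
    mul_one := shuffle_one_right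
    mul_assoc := shuffle_assoc
    mul_comm := shuffle_comm
    left_distrib := fun u v w => map_add (shuffle (k := k) (M := M) u) v w
    right_distrib := fun u v w => LinearMap.map_add₂ (shuffle (k := k) (M := M)) u v w
    zero_mul := fun v => LinearMap.map_zero₂ (shuffle (k := k) (M := M)) v
    mul_zero := fun v => map_zero (shuffle (k := k) (M := M) v) }

instance : Algebra k (ShuffleAlgebra k M) :=
  Algebra.ofModule
    (fun r v w => LinearMap.map_smul₂ (shuffle (k := k) (M := M)) r v w)
    (fun r v w => map_smul (shuffle (k := k) (M := M) v) r w)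

variable {k M}

/-- The identity map from the tensor module to the shuffle algebra. -/
def toShuffle : TensorAlgebra k M ≃ₗ[k] ShuffleAlgebra k M := LinearEquiv.refl k _

theorem toShuffle_one : toShuffle (1 : TensorAlgebra k M) = 1 := rfl

theorem toShuffle_mul (v w : TensorAlgebra k M) :
    toShuffle v * toShuffle w = toShuffle (shuffle v w) := rfl

end Shuffle

/-! ### The free objects -/

section Free

variable {k : Type*} (Ω A : Type*) {B : Type*} [CommRing k] [CommRing A] [Algebra k A]
  [CommRing B] [Algebra k B]

/-- The augmentation ideal `B⁺ = ker ε` of an augmented algebra `ε : B → k`, so that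
`B = k ⊕ B⁺`. -/
abbrev augIdeal (ε : B →ₐ[k] k) : Submodule k B := LinearMap.ker ε.toLinearMap

/-- The module `kΩ ⊗ (A ⊗ B⁺)`. -/
abbrev Letter (ε : B →ₐ[k] k) : Type _ := (Ω →₀ k) ⊗[k] (A ⊗[k] augIdeal ε)

/-- The algebra `Sh(A, B) = ⨁ₙ (A ⊗ B) ⊗ (kΩ ⊗ A ⊗ B⁺)^{⊗ n}`, as the tensor product of the
algebra `A ⊗ B` with the shuffle algebra on the module `kΩ ⊗ A ⊗ B⁺`. -/
abbrev Sh (ε : B →ₐ[k] k) : Type _ := (A ⊗[k] B) ⊗[k] ShuffleAlgebra k (Letter Ω A ε)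

/-- The underlying module of `Sh(A, B)` is `⨁ₙ (A ⊗ B) ⊗ (kΩ ⊗ A ⊗ B⁺)^{⊗ n}`. -/
def shEquivDirectSum (ε : B →ₐ[k] k) :
    Sh Ω A ε ≃ₗ[k] ⨁ n : ℕ, (A ⊗[k] B) ⊗[k] (⨂[k]^n (Letter Ω A ε)) :=
  TensorProduct.congr (LinearEquiv.refl k (A ⊗[k] B))
    (toShuffle.symm ≪≫ₗ (TensorAlgebra.equivDirectSum (R := k)).toLinearEquiv) ≪≫ₗ
    TensorProduct.directSumRight k k (A ⊗[k] B) (fun n : ℕ => ⨂[k]^n (Letter Ω A ε))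

variable {Ω A}

/-- The inclusion `A ⊗ B⁺ → A ⊗ B`. -/
def plusIncl (ε : B →ₐ[k] k) : A ⊗[k] augIdeal ε →ₗ[k] A ⊗[k] B :=
  (augIdeal ε).subtype.lTensor A

/-- The projection `b ↦ b - ε(b)` of `B = k ⊕ B⁺` onto `B⁺`. -/
def augProj (ε : B →ₐ[k] k) : B →ₗ[k] augIdeal ε :=
  (LinearMap.id - Algebra.linearMap k B ∘ₗ ε.toLinearMap).codRestrict (augIdeal ε)
    (fun b => by simp)

theorem augProj_coe (ε : B →ₐ[k] k) (b : B) :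
    (augProj ε b : B) = b - algebraMap k B (ε b) := rfl

/-- The projection of `A ⊗ B = A ⊕ (A ⊗ B⁺)` onto `A ⊗ B⁺`. -/
def plusProj (ε : B →ₐ[k] k) : A ⊗[k] B →ₗ[k] A ⊗[k] augIdeal ε := (augProj ε).lTensor A

/-- The projection of `A ⊗ B = A ⊕ (A ⊗ B⁺)` onto `A`. -/
def baseProj (ε : B →ₐ[k] k) : A ⊗[k] B →ₗ[k] A :=
  (TensorProduct.rid k A).toLinearMap ∘ₗ ε.toLinearMap.lTensor A

theorem plusProj_plusIncl (ε : B →ₐ[k] k) (x : A ⊗[k] augIdeal ε) :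
    plusProj ε (plusIncl ε x) = x := by
  have : augProj ε ∘ₗ (augIdeal ε).subtype = LinearMap.id := by
    ext ⟨b, hb⟩
    have hb' : ε b = 0 := hb
    simp [augProj_coe, hb']
  rw [plusProj, plusIncl, ← LinearMap.comp_apply, ← LinearMap.lTensor_comp, this,
    LinearMap.lTensor_id, LinearMap.id_apply]

theorem baseProj_plusIncl (ε : B →ₐ[k] k) (x : A ⊗[k] augIdeal ε) :
    baseProj ε (plusIncl ε x) = 0 := by
  have : ε.toLinearMap ∘ₗ (augIdeal ε).subtype = 0 := by
    ext ⟨b, hb⟩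
    exact hb
  rw [baseProj, plusIncl, LinearMap.comp_apply, ← LinearMap.comp_apply (LinearMap.lTensor A _),
    ← LinearMap.lTensor_comp, this]
  simp

theorem plusProj_base (ε : B →ₐ[k] k) (a : A) : plusProj ε (a ⊗ₜ[k] (1 : B)) = 0 := by
  have : augProj ε 1 = 0 := by ext; simp [augProj_coe]
  simp [plusProj, this]

theorem baseProj_base (ε : B →ₐ[k] k) (a : A) : baseProj ε (a ⊗ₜ[k] (1 : B)) = a := by
  simp [baseProj]

/-- The action of `A` on `kΩ ⊗ A ⊗ B⁺` through the factor `A`: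
`a · (ω ⊗ u) = ω ⊗ (a u)`. -/
def letterAct (ε : B →ₐ[k] k) : A →ₗ[k] Module.End k (Letter Ω A ε) :=
  LinearMap.lTensorHom (Ω →₀ k) ∘ₗ (Algebra.lsmul k k (A ⊗[k] augIdeal ε)).toLinearMap

/-- The action of `A` on the first letter of a word: `a · 1 = 0` and
`a · ((ω ⊗ u) ⊗ w) = (ω ⊗ (a u)) ⊗ w`. -/
def headAct (ε : B →ₐ[k] k) : A →ₗ[k] Module.End k (TensorAlgebra k (Letter Ω A ε)) where
  toFun a := tensorRec 0 (cons ∘ₗ letterAct ε a) 0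
  map_add' a b := by
    ext w
    rw [LinearMap.add_apply]
    induction w using cons_induction with
    | one => simp [tensorRec_one]
    | cons_mem m v h => simp [tensorRec_cons]
    | add v w hv hw => simp only [LinearMap.map_add _ v w, hv, hw]; abel
    | smul r v hv => simp only [LinearMap.map_smul _ r v, hv, smul_add]
  map_smul' r a := by
    ext w
    rw [LinearMap.smul_apply]
    induction w using cons_induction with
    | one => simp [tensorRec_one]
    | cons_mem m v h => simp [tensorRec_cons]
    | add v w hv hw => simp only [LinearMap.map_add _ v w, hv, hw, smul_add]
    | smul s v hv => simp only [LinearMap.map_smul _ s v, hv, smul_comm s]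

theorem headAct_one (ε : B →ₐ[k] k) (a : A) : headAct (Ω := Ω) ε a 1 = 0 := tensorRec_one _ _ _

theorem headAct_cons (ε : B →ₐ[k] k) (a : A) (m : Letter Ω A ε)
    (w : TensorAlgebra k (Letter Ω A ε)) :
    headAct ε a (cons m w) = cons (letterAct ε a m) w := by
  simp [headAct, tensorRec_cons]

/-- The word `(ω₁ ⊗ u₁) ⊗ ⋯ ⊗ (ωₙ ⊗ uₙ)` with letters `ωᵢ ∈ Ω` and `uᵢ ∈ A ⊗ B⁺`. -/
def word {ε : B →ₐ[k] k} : List (Ω × (A ⊗[k] augIdeal ε)) → TensorAlgebra k (Letter Ω A ε)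
  | [] => 1
  | (ω, x) :: l => cons (Finsupp.single ω (1 : k) ⊗ₜ[k] x) (word l)

/-- The pure tensor `u₀ ⊗ (ω₁ ⊗ u₁) ⊗ ⋯ ⊗ (ωₙ ⊗ uₙ)` of `Sh(A, B)`. -/
def pure {ε : B →ₐ[k] k} (u₀ : A ⊗[k] B) (l : List (Ω × (A ⊗[k] augIdeal ε))) : Sh Ω A ε :=
  u₀ ⊗ₜ[k] toShuffle (word l)

/-- The operators `P_{F,ω}` on `Sh(A, B)` attached to operators `φ_ω` on `A`: linearly in
`u₀ ∈ A ⊗ B = A ⊕ (A ⊗ B⁺)` and in the word `w`,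
`P_{F,ω}(u₀ ⊗ w) = φ_ω(u₀) ⊗ w - 1 ⊗ (φ_ω(u₀) · w)` for `u₀ ∈ A`, with `A` acting on the first
letter of `w` (the second term is zero for the empty word), and
`P_{F,ω}(u₀ ⊗ w) = 1 ⊗ (ω ⊗ u₀) ⊗ w` for `u₀ ∈ A ⊗ B⁺`. -/
def freeOp (φ : Ω → A →ₗ[k] A) (ε : B →ₐ[k] k) (ω : Ω) : Sh Ω A ε →ₗ[k] Sh Ω A ε :=
  let tens : A ⊗[k] B →ₗ[k] TensorAlgebra k (Letter Ω A ε) →ₗ[k] Sh Ω A ε :=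
    (TensorProduct.mk k (A ⊗[k] B) (ShuffleAlgebra k (Letter Ω A ε))).compl₂
      toShuffle.toLinearMap
  let onBase : A →ₗ[k] TensorAlgebra k (Letter Ω A ε) →ₗ[k] Sh Ω A ε :=
    tens ∘ₗ (TensorProduct.mk k A B).flip 1 - (headAct ε).compr₂ (tens 1)
  let onPlus : A ⊗[k] augIdeal ε →ₗ[k] TensorAlgebra k (Letter Ω A ε) →ₗ[k] Sh Ω A ε :=
    (cons ∘ₗ TensorProduct.mk k (Ω →₀ k) (A ⊗[k] augIdeal ε) (Finsupp.single ω 1)).compr₂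
      (tens 1)
  TensorProduct.lift
    ((onBase ∘ₗ φ ω ∘ₗ baseProj ε + onPlus ∘ₗ plusProj ε).compl₂ toShuffle.symm.toLinearMap)

/-- The natural inclusion `j_F : A → Sh(A, B)`. -/
def inclA (ε : B →ₐ[k] k) : A →ₐ[k] Sh Ω A ε :=
  Algebra.TensorProduct.includeLeft.comp Algebra.TensorProduct.includeLeft

/-- The natural inclusion `i_B : B → Sh(A, B)`. -/
def inclB (ε : B →ₐ[k] k) : B →ₐ[k] Sh Ω A ε :=
  Algebra.TensorProduct.includeLeft.comp Algebra.TensorProduct.includeRight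

/-- The twists `a_{F,ω} = j_F(a_ω)` of `Sh(A, B)`. -/
def freeTwist (a : Ω → Aˣ) (ε : B →ₐ[k] k) (ω : Ω) : (Sh Ω A ε)ˣ :=
  Units.map (inclA (Ω := Ω) (A := A) ε).toRingHom.toMonoidHom (a ω)

/-- The operators `ρ_ω^{a_ω⁻¹} : x ↦ a_ω⁻¹ ρ_ω(a_ω x)` on `A`. -/
def untwist (ρ : Ω → A →ₗ[k] A) (a : Ω → Aˣ) (ω : Ω) : A →ₗ[k] A := twistOp (a ω)⁻¹ (ρ ω)

/-- The operators `P_{F,ω}^{a_{F,ω}}` on `Sh(A, B)`, where `P_{F,Ω}` is attached to the operators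
`ρ_ω^{a_ω⁻¹}` on `A`. -/
def freeTwistedOp (ρ : Ω → A →ₗ[k] A) (a : Ω → Aˣ) (ε : B →ₐ[k] k) (ω : Ω) :
    Sh Ω A ε →ₗ[k] Sh Ω A ε :=
  twistOp (freeTwist a ε ω) (freeOp (untwist ρ a) ε ω)

/-! The operators and the product on pure tensors. -/

section PureTensors

variable {ε : B →ₐ[k] k} (φ : Ω → A →ₗ[k] A)

theorem freeOp_base_nil (ω : Ω) (a : A) :
    freeOp φ ε ω (pure (a ⊗ₜ 1) []) = pure (φ ω a ⊗ₜ 1) [] := by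
  simp [freeOp, pure, word, plusProj_base, baseProj_base, headAct_one]

theorem freeOp_base_cons (ω ω₁ : Ω) (a : A) (x : A ⊗[k] augIdeal ε)
    (l : List (Ω × (A ⊗[k] augIdeal ε))) :
    freeOp φ ε ω (pure (a ⊗ₜ 1) ((ω₁, x) :: l)) =
      pure (φ ω a ⊗ₜ 1) ((ω₁, x) :: l) - pure 1 ((ω₁, φ ω a • x) :: l) := by
  simp [freeOp, pure, word, plusProj_base, baseProj_base, headAct_cons, letterAct]

theorem freeOp_plus_tmul (ω : Ω) (x : A ⊗[k] augIdeal ε) (w : TensorAlgebra k (Letter Ω A ε)) :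
    freeOp φ ε ω (plusIncl ε x ⊗ₜ[k] toShuffle w) =
      1 ⊗ₜ[k] toShuffle (cons (Finsupp.single ω (1 : k) ⊗ₜ[k] x) w) := by
  simp [freeOp, plusProj_plusIncl, baseProj_plusIncl]

theorem freeOp_plus (ω : Ω) (x : A ⊗[k] augIdeal ε) (l : List (Ω × (A ⊗[k] augIdeal ε))) :
    freeOp φ ε ω (pure (plusIncl ε x) l) = pure 1 ((ω, x) :: l) := by
  simp [freeOp, pure, word, plusProj_plusIncl, baseProj_plusIncl]

theorem pure_nil_mul (u₀ v₀ : A ⊗[k] B) (l : List (Ω × (A ⊗[k] augIdeal ε))) :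
    pure u₀ [] * pure v₀ l = pure (u₀ * v₀) l := by
  simp [pure, word, toShuffle_one]

theorem mul_pure_nil (u₀ v₀ : A ⊗[k] B) (l : List (Ω × (A ⊗[k] augIdeal ε))) :
    pure u₀ l * pure v₀ [] = pure (u₀ * v₀) l := by
  simp [pure, word, toShuffle_one]

theorem pure_cons_mul_pure_cons (u₀ v₀ : A ⊗[k] B) (α β : Ω) (x y : A ⊗[k] augIdeal ε)
    (l l' : List (Ω × (A ⊗[k] augIdeal ε))) :
    pure u₀ ((α, x) :: l) * pure v₀ ((β, y) :: l') =
      pure (u₀ * v₀) [] *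
          freeOp φ ε β (freeOp φ ε α (pure (plusIncl ε x) l) * pure (plusIncl ε y) l') +
        pure (u₀ * v₀) [] *
          freeOp φ ε α (pure (plusIncl ε x) l * freeOp φ ε β (pure (plusIncl ε y) l')) := by
  have h1 : pure (plusIncl ε x) l * pure 1 ((β, y) :: l') =
      plusIncl ε x ⊗ₜ[k] toShuffle (shuffle (word l) (word ((β, y) :: l'))) := by
    simp [pure, toShuffle_mul]
  have h2 : pure 1 ((α, x) :: l) * pure (plusIncl ε y) l' =
      plusIncl ε y ⊗ₜ[k] toShuffle (shuffle (word ((α, x) :: l)) (word l')) := by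
    simp [pure, toShuffle_mul]
  rw [freeOp_plus, freeOp_plus, h1, h2, freeOp_plus_tmul, freeOp_plus_tmul]
  simp only [pure, word, toShuffle_one, Algebra.TensorProduct.tmul_mul_tmul, toShuffle_mul,
    shuffle_cons_cons, mul_one, one_mul, map_add, TensorProduct.tmul_add]
  rw [add_comm]

theorem shEquivDirectSum_pure (u₀ : A ⊗[k] B)
    (l : List (Ω × (A ⊗[k] augIdeal ε))) :
    shEquivDirectSum Ω A ε (pure u₀ l) =
      DirectSum.lof k ℕ (fun n => (A ⊗[k] B) ⊗[k] (⨂[k]^n (Letter Ω A ε))) l.length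
        (u₀ ⊗ₜ[k] PiTensorProduct.tprod k
          (fun i : Fin l.length => Finsupp.single (l.get i).1 (1 : k) ⊗ₜ[k] (l.get i).2)) := by
  have h : word l = TensorAlgebra.tprod k (Letter Ω A ε) l.length
      (fun i : Fin l.length => Finsupp.single (l.get i).1 (1 : k) ⊗ₜ[k] (l.get i).2) := by
    rw [TensorAlgebra.tprod_apply]
    induction l with
    | nil => simp [word]
    | cons p l ih => simp [word, cons_apply, ih]
  simp only [pure, shEquivDirectSum, h, LinearEquiv.trans_apply, TensorProduct.congr_tmul,
    LinearEquiv.refl_apply, LinearEquiv.symm_apply_apply, AlgEquiv.toLinearEquiv_apply]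
  rw [show TensorAlgebra.equivDirectSum (R := k) (TensorAlgebra.tprod k (Letter Ω A ε) l.length
      (fun i : Fin l.length => Finsupp.single (l.get i).1 (1 : k) ⊗ₜ[k] (l.get i).2)) = _ from
    TensorAlgebra.toDirectSum_tensorPower_tprod _]
  exact TensorProduct.directSumRight_tmul_lof k (S := k) (M₁' := A ⊗[k] B)
    (M₂ := fun n : ℕ => ⨂[k]^n (Letter Ω A ε)) u₀ l.length _

end PureTensors

end Free

end MTRBA

end

noncomputable section

namespace MTRBA

/-! ### Untwisting matching twisted Rota-Baxter algebras -/

section Untwisting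

variable {k Ω A B R S F : Type*} [CommRing k]
  [CommRing A] [Algebra k A] [CommRing B] [Algebra k B] [CommRing R] [Algebra k R]
  [CommRing S] [Algebra k S] [CommRing F] [Algebra k F]

/-! Conjugating by the twists turns the twisted identity into the untwisted one
(`isMTRBA_iff_isMRBA_untwist`), and homomorphisms correspond as well. The twist of a relative MTRBA
is the image of the twist of `A`, so relative MTRBAs over `(A, ρ, a)` are the same as relative MRBAs
over `(A, φ)`, and a free object on one side gives a free object on the other. Only the untwisted
case needs work.

There, the word `(ω₁ ⊗ u₁) ⊗ ⋯ ⊗ (ωₙ ⊗ uₙ)` is a normal form of the nested expression `P_{ω₁}(u₁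
P_{ω₂}(u₂ ⋯ P_{ωₙ}(uₙ)))`. Expanding a product of two such expressions by the matching Rota-Baxter
identity is exactly the shuffle recursion. When the argument has its coefficient in `A`, the
operator is forced: `φ_ω(a) P_β(y) = P_ω(a P_β(y)) + P_β(φ_ω(a) y)` determines `P_ω(a P_β(y))`,
which gives the two-term formula with `A` acting on the first letter.

Two things remain. These operators must satisfy the identity (`isMRBA_freeOp`), which depends on how
the first-letter action meets the shuffle product (`headAct_shuffle_cons`,
`shuffle_headAct_headAct`). And evaluating words in any relative MRBA must give a homomorphism
(`wordLift_shuffle`, `isMRBAHom_shLift`), unique because words are iterated values of the operators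
(`algHom_ext_of_isMRBAHom`). -/

theorem twistOp_apply (a : Rˣ) (Q : R →ₗ[k] R) (r : R) :
    twistOp a Q r = a * Q ((a⁻¹ : Rˣ) * r) := rfl

theorem twistOp_inv_twistOp (a : Rˣ) (Q : R →ₗ[k] R) : twistOp a⁻¹ (twistOp a Q) = Q := by
  ext r
  simp [twistOp_apply]

theorem untwist_apply (P : Ω → R →ₗ[k] R) (a : Ω → Rˣ) (ω : Ω) (r : R) :
    untwist P a ω r = ((a ω)⁻¹ : Rˣ) * P ω (a ω * r) := by
  simp [untwist, twistOp_apply]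

theorem untwist_twistOp (P : Ω → R →ₗ[k] R) (a : Ω → Rˣ) :
    untwist (fun ω => twistOp (a ω) (P ω)) a = P :=
  funext fun ω => twistOp_inv_twistOp (a ω) (P ω)

theorem apply_eq_untwist (P : Ω → R →ₗ[k] R) (a : Ω → Rˣ) (ω : Ω) (r : R) :
    P ω r = a ω * untwist P a ω (((a ω)⁻¹ : Rˣ) * r) := by
  simp [untwist_apply]

/-- Substitute `a_α x` and `a_β y` for `x` and `y` in the twisted identity and multiply by `a_α⁻¹
a_β⁻¹`; the inverse substitution goes back. -/
theorem isMTRBA_iff_isMRBA_untwist {P : Ω → R →ₗ[k] R} {a : Ω → Rˣ} :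
    IsMTRBA P a ↔ IsMRBA (untwist P a) := by
  constructor
  · intro h α β x y
    have e := congrArg (fun z => (((a α)⁻¹ : Rˣ) : R) * (((a β)⁻¹ : Rˣ) : R) * z)
      (h α β (a α * x) (a β * y))
    simp only [untwist_apply]
    -- The arguments of the operators are first brought to the shape found in `untwist`; afterwards
    -- only scalar factors `a⁻¹ a` outside the operators have to cancel.
    have h1 : ((a β)⁻¹ : Rˣ) * (a α * x * P β (a β * y)) =
        a α * (x * (((a β)⁻¹ : Rˣ) * P β (a β * y))) := by ring
    have h2 : ((a α)⁻¹ : Rˣ) * (P α (a α * x) * (a β * y)) =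
        a β * (((a α)⁻¹ : Rˣ) * P α (a α * x) * y) := by ring
    rw [h1, h2] at e
    linear_combination e +
      (((a β)⁻¹ : Rˣ) : R) * P β (a β * (((a α)⁻¹ : Rˣ) * P α (a α * x) * y)) *
        (a α).inv_mul +
      (((a α)⁻¹ : Rˣ) : R) * P α (a α * (x * (((a β)⁻¹ : Rˣ) * P β (a β * y)))) *
        (a β).inv_mul
  · intro h α β x y
    have e := congrArg (fun z => (a α : R) * (a β : R) * z)
      (h α β (((a α)⁻¹ : Rˣ) * x) (((a β)⁻¹ : Rˣ) * y))
    simp only [apply_eq_untwist P a]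
    have h1 : (((a α)⁻¹ : Rˣ) : R) * (((a β)⁻¹ : Rˣ) *
          (x * (a β * untwist P a β (((a β)⁻¹ : Rˣ) * y)))) =
        ((a α)⁻¹ : Rˣ) * x * untwist P a β (((a β)⁻¹ : Rˣ) * y) := by
      linear_combination (((a α)⁻¹ : Rˣ) * x * untwist P a β (((a β)⁻¹ : Rˣ) * y)) *
        (a β).inv_mul
    have h2 : (((a β)⁻¹ : Rˣ) : R) * (((a α)⁻¹ : Rˣ) *
          (a α * untwist P a α (((a α)⁻¹ : Rˣ) * x) * y)) =
        untwist P a α (((a α)⁻¹ : Rˣ) * x) * (((a β)⁻¹ : Rˣ) * y) := by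
      linear_combination (untwist P a α (((a α)⁻¹ : Rˣ) * x) * (((a β)⁻¹ : Rˣ) * y)) *
        (a α).inv_mul
    rw [h1, h2]
    linear_combination e

theorem map_inv_of_map_twist {a : Rˣ} {b : Sˣ} {f : R →ₐ[k] S} (h : f (a : R) = b) :
    f ((a⁻¹ : Rˣ) : R) = ((b⁻¹ : Sˣ) : S) := by
  rw [← Units.mul_eq_one_iff_eq_inv, ← h, ← map_mul, Units.inv_mul, map_one]

theorem isMTRBAHom_iff_isMRBAHom_untwist {P : Ω → R →ₗ[k] R} {a : Ω → Rˣ} {Q : Ω → S →ₗ[k] S}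
    {b : Ω → Sˣ} {f : R →ₐ[k] S} :
    IsMTRBAHom P a Q b f ↔
      (∀ ω, f (a ω : R) = b ω) ∧ IsMRBAHom (untwist P a) (untwist Q b) f := by
  refine ⟨fun h => ⟨h.map_twist, fun ω x => ?_⟩, fun h => ⟨h.1, fun ω x => ?_⟩⟩
  · simp only [untwist_apply, map_mul, h.map_op, h.map_twist, map_inv_of_map_twist (h.map_twist ω)]
  · rw [apply_eq_untwist P a, apply_eq_untwist Q b, map_mul, h.1, h.2, map_mul,
      map_inv_of_map_twist (h.1 ω)]

/-- The twist `b` is forced to be the image of `a` under `j`, so it carries no extra data. -/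
theorem isRelMTRBA_iff_isRelMRBA_untwist {ρ : Ω → A →ₗ[k] A} {a : Ω → Aˣ} {P : Ω → R →ₗ[k] R}
    {b : Ω → Rˣ} {j : A →ₐ[k] R} :
    IsRelMTRBA ρ a P b j ↔
      (∀ ω, j (a ω : A) = b ω) ∧ IsRelMRBA (untwist ρ a) (untwist P b) j := by
  constructor
  · intro h
    have := isMTRBAHom_iff_isMRBAHom_untwist.1 h.isHom
    exact ⟨this.1, isMTRBA_iff_isMRBA_untwist.1 h.isMTRBA, this.2⟩
  · intro h
    exact ⟨isMTRBA_iff_isMRBA_untwist.2 h.2.isMRBA,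
      isMTRBAHom_iff_isMRBAHom_untwist.2 ⟨h.1, h.2.isHom⟩⟩

/-- Twisting a free `(A, ρ_Ω^{a_Ω⁻¹})`-MRBA yields a free `(A, ρ_Ω, a_Ω)`-MTRBA. -/
theorem IsFreeMRBA.isFreeMTRBA {ρ : Ω → A →ₗ[k] A} {a : Ω → Aˣ} {P : Ω → F →ₗ[k] F}
    {aF : Ω → Fˣ} {j : A →ₐ[k] F} {i : B →ₐ[k] F} (h : IsFreeMRBA.{w} (untwist ρ a) P j i)
    (haF : ∀ ω, j (a ω : A) = aF ω) :
    IsFreeMTRBA.{w} ρ a (fun ω => twistOp (aF ω) (P ω)) aF j i where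
  isRel := isRelMTRBA_iff_isRelMRBA_untwist.2 ⟨haF, by rw [untwist_twistOp]; exact h.isRel⟩
  universal R _ _ Q aR jR hR f := by
    obtain ⟨hj, hR⟩ := isRelMTRBA_iff_isRelMRBA_untwist.1 hR
    obtain ⟨g, ⟨hg, hgj, hgi⟩, huniq⟩ := h.universal R (untwist Q aR) jR hR f
    refine ⟨g, ⟨isMTRBAHom_iff_isMRBAHom_untwist.2 ⟨fun ω => ?_, ?_⟩, hgj, hgi⟩, ?_⟩
    -- Preservation of twists is automatic: both twists are images of `a ω`, and `g` is compatible
    -- with the structure maps.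
    · rw [← haF, ← hj, hgj]; rfl
    · rwa [untwist_twistOp]
    · rintro g' ⟨hg', hgj', hgi'⟩
      refine huniq g' ⟨?_, hgj', hgi'⟩
      have := (isMTRBAHom_iff_isMRBAHom_untwist.1 hg').2
      rwa [untwist_twistOp] at this

end Untwisting

/-! ### The matching Rota-Baxter identity on `Sh(A, B)` -/

section FreeObject

variable {k Ω A B : Type*} [CommRing k] [CommRing A] [Algebra k A] [CommRing B] [Algebra k B]
  {ε : B →ₐ[k] k}

/-- The letter `ω ⊗ x`. -/
def letter (ω : Ω) (x : A ⊗[k] augIdeal ε) : Letter Ω A ε := Finsupp.single ω (1 : k) ⊗ₜ[k] x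

theorem letterAct_letter (a : A) (ω : Ω) (x : A ⊗[k] augIdeal ε) :
    letterAct ε a (letter ω x) = letter ω (a • x) := by
  simp [letterAct, letter]

/-- Pure letters `ω ⊗ x` span the letter module, and it is on them that the actions and evaluations
have closed formulas. -/
theorem word_induction {C : TensorAlgebra k (Letter Ω A ε) → Prop} (one : C 1)
    (cons_mem : ∀ ω x v, C v → C (cons (letter ω x) v)) (add : ∀ v w, C v → C w → C (v + w))
    (smul : ∀ (r : k) v, C v → C (r • v)) (v : TensorAlgebra k (Letter Ω A ε)) : C v := by
  induction v using cons_induction with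
  | one => exact one
  | cons_mem m v hv =>
    have zero : C 0 := by simpa using smul 0 v hv
    induction m using TensorProduct.induction_on with
    | zero => simpa using zero
    | add m n hm hn => rw [map_add, LinearMap.add_apply]; exact add _ _ hm hn
    | tmul p x =>
      induction p using Finsupp.induction_linear with
      | zero => simpa using zero
      | add p q hp hq =>
        rw [TensorProduct.add_tmul, map_add, LinearMap.add_apply]
        exact add _ _ hp hq
      | single ω r =>
        have : Finsupp.single ω r ⊗ₜ[k] x = r • letter (k := k) ω x := by
          rw [letter, TensorProduct.smul_tmul', Finsupp.smul_single, smul_eq_mul, mul_one]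
        rw [this, map_smul, LinearMap.smul_apply]
        exact smul _ _ (cons_mem _ _ _ hv)
  | add v w hv hw => exact add v w hv hw
  | smul r v hv => exact smul r v hv

/-- `Sh(A, B)` is spanned by the tensors `u ⊗ w` with `u ∈ A` or `u ∈ A ⊗ B⁺`. -/
theorem sh_induction {C : Sh Ω A ε → Prop}
    (base : ∀ (a : A) w, C ((a ⊗ₜ[k] 1) ⊗ₜ[k] toShuffle w))
    (plus : ∀ (x : A ⊗[k] augIdeal ε) w, C (plusIncl ε x ⊗ₜ[k] toShuffle w))
    (add : ∀ X Y, C X → C Y → C (X + Y)) (X : Sh Ω A ε) : C X := by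
  induction X using TensorProduct.induction_on with
  | zero => simpa using base 0 1
  | add X Y hX hY => exact add X Y hX hY
  | tmul u w =>
    rw [← toShuffle.apply_symm_apply w]
    induction u using TensorProduct.induction_on with
    | zero => simpa using base 0 1
    | add u v hu hv => rw [TensorProduct.add_tmul]; exact add _ _ hu hv
    | tmul a b =>
      have : a ⊗ₜ[k] b = (ε b • a) ⊗ₜ[k] 1 + plusIncl ε (a ⊗ₜ[k] augProj ε b) := by
        rw [plusIncl, LinearMap.lTensor_tmul, Submodule.subtype_apply, augProj_coe,
          TensorProduct.smul_tmul, ← Algebra.algebraMap_eq_smul_one, ← TensorProduct.tmul_add,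
          add_sub_cancel]
      rw [this, TensorProduct.add_tmul]
      exact add _ _ (base _ _) (plus _ _)

/-! ### The first-letter action of `A` and the shuffle product. -/

theorem headAct_mul (a b : A) (w : TensorAlgebra k (Letter Ω A ε)) :
    headAct ε (a * b) w = headAct ε a (headAct ε b w) := by
  induction w using word_induction with
  | one => simp [headAct_one]
  | cons_mem ω x w h => simp only [headAct_cons, letterAct_letter, mul_smul]
  | add v w hv hw => simp only [map_add, hv, hw]
  | smul r v hv => simp only [map_smul, hv]

/-- A term of `v ⧢ (n ⊗ w)` begins with the first letter of `v` or with `n`. Letting `b` act on `v`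
beforehand is right for the first kind; the last two terms correct the second kind. -/
theorem headAct_shuffle_cons (b : A) (v : TensorAlgebra k (Letter Ω A ε)) (n : Letter Ω A ε)
    (w : TensorAlgebra k (Letter Ω A ε)) :
    headAct ε b (shuffle v (cons n w)) =
      shuffle (headAct ε b v) (cons n w) + cons (letterAct ε b n) (shuffle v w) -
        cons n (shuffle (headAct ε b v) w) := by
  induction v using cons_induction with
  | one => simp [shuffle_one_left, headAct_one, headAct_cons]
  | cons_mem m v h =>
    simp only [shuffle_cons_cons, headAct_cons, map_add]
    abel
  | add v w hv hw => simp only [map_add, LinearMap.add_apply, hv, hw]; abel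
  | smul r v hv => simp only [map_smul, LinearMap.smul_apply, hv, smul_add, smul_sub]

/-- Needed for the Rota-Baxter identity when both coefficients lie in `A`. On nonempty words each
side splits by the origin of the leading letter, and the terms where `b * d` hits that letter
cancel. -/
theorem shuffle_headAct_headAct (b d : A) (v w : TensorAlgebra k (Letter Ω A ε)) :
    shuffle (headAct ε b v) (headAct ε d w) =
      headAct ε b (shuffle v (headAct ε d w)) + headAct ε d (shuffle (headAct ε b v) w) -
        headAct ε (b * d) (shuffle v w) := by
  induction w using word_induction with
  | one => simp [shuffle_one_right, headAct_one, mul_comm b d, headAct_mul]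
  | cons_mem ω x w h =>
    -- Acting by `d` before or after shuffling produces the same correction terms, since `b` and `d`
    -- commute; subtracting the two formulas leaves the claim.
    have hb := headAct_shuffle_cons b v (letter ω (d • x)) w
    have hd := congrArg (headAct ε d) (headAct_shuffle_cons b v (letter ω x) w)
    have hx : b • d • x = d • b • x := by rw [← mul_smul, mul_comm, mul_smul]
    simp only [map_add, map_sub, headAct_cons, letterAct_letter] at hb hd
    rw [mul_comm b d, headAct_mul, headAct_cons, letterAct_letter, hb, hd, hx]
    abel
  | add x y hx hy => simp only [map_add, hx, hy]; abel
  | smul r v hv => simp only [map_smul, hv, smul_add, smul_sub]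

theorem freeOp_base_tmul (φ : Ω → A →ₗ[k] A) (ω : Ω) (a : A)
    (w : TensorAlgebra k (Letter Ω A ε)) :
    freeOp φ ε ω ((a ⊗ₜ[k] 1) ⊗ₜ[k] toShuffle w) =
      (φ ω a ⊗ₜ[k] 1) ⊗ₜ[k] toShuffle w - 1 ⊗ₜ[k] toShuffle (headAct ε (φ ω a) w) := by
  simp [freeOp, plusProj_base, baseProj_base]

theorem freeOp_plusIncl_tmul (φ : Ω → A →ₗ[k] A) (ω : Ω) (x : A ⊗[k] augIdeal ε)
    (w : TensorAlgebra k (Letter Ω A ε)) :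
    freeOp φ ε ω (plusIncl ε x ⊗ₜ[k] toShuffle w) =
      1 ⊗ₜ[k] toShuffle (cons (letter ω x) w) :=
  freeOp_plus_tmul φ ω x w

theorem base_mul_plusIncl (a : A) (x : A ⊗[k] augIdeal ε) :
    (a ⊗ₜ[k] (1 : B)) * plusIncl ε x = plusIncl ε (a • x) := by
  induction x using TensorProduct.induction_on with
  | zero => simp
  | add x y hx hy => simp only [map_add, mul_add, smul_add, hx, hy]
  | tmul c b => simp [plusIncl, TensorProduct.smul_tmul']

/-- By bilinearity each coefficient may be taken in `A` or in `A ⊗ B⁺`. With both in `A ⊗ B⁺` the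
identity is the shuffle recursion; the mixed case is `headAct_shuffle_cons`; with both in `A` it
combines `hφ` with `shuffle_headAct_headAct`. -/
theorem isMRBA_freeOp {φ : Ω → A →ₗ[k] A} (hφ : IsMRBA φ) : IsMRBA (freeOp φ ε) := by
  -- Isolated because it settles both mixed cases: the identity is symmetric under exchanging `(α,
  -- x)` with `(β, y)`.
  have base_plus : ∀ (α β : Ω) (a : A) (v : TensorAlgebra k (Letter Ω A ε))
      (y : A ⊗[k] augIdeal ε) (w : TensorAlgebra k (Letter Ω A ε)),
      freeOp φ ε α ((a ⊗ₜ[k] 1) ⊗ₜ[k] toShuffle v) *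
          freeOp φ ε β (plusIncl ε y ⊗ₜ[k] toShuffle w) =
        freeOp φ ε α ((a ⊗ₜ[k] 1) ⊗ₜ[k] toShuffle v *
          freeOp φ ε β (plusIncl ε y ⊗ₜ[k] toShuffle w)) +
        freeOp φ ε β (freeOp φ ε α ((a ⊗ₜ[k] 1) ⊗ₜ[k] toShuffle v) *
          plusIncl ε y ⊗ₜ[k] toShuffle w) := by
    intro α β a v y w
    simp only [freeOp_base_tmul, freeOp_plusIncl_tmul, sub_mul,
      Algebra.TensorProduct.tmul_mul_tmul, toShuffle_mul, mul_one, one_mul, map_sub,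
      base_mul_plusIncl, headAct_shuffle_cons, map_add, TensorProduct.tmul_add,
      TensorProduct.tmul_sub, letterAct_letter]
    abel
  intro α β X Y
  induction X using sh_induction with
  | add X X' hX hX' =>
    simp only [map_add, add_mul, hX, hX']; abel
  | base a v =>
    induction Y using sh_induction with
    | add Y Y' hY hY' => simp only [map_add, mul_add, hY, hY']; abel
    | plus y w => exact base_plus α β a v y w
    | base c w =>
      simp only [freeOp_base_tmul, sub_mul, mul_sub, Algebra.TensorProduct.tmul_mul_tmul,
        toShuffle_mul, mul_one, one_mul, map_sub]
      -- The product `φ_α(a) φ_β(c)` occurs twice: as the coefficient in `A`, and, once the shuffle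
      -- of two acted words is expanded, acting on a first letter.
      rw [hφ α β a c, shuffle_headAct_headAct, hφ α β a c]
      simp only [map_add, map_sub, LinearMap.add_apply, TensorProduct.add_tmul,
        TensorProduct.tmul_add, TensorProduct.tmul_sub]
      abel
  | plus x v =>
    induction Y using sh_induction with
    | add Y Y' hY hY' => simp only [map_add, mul_add, hY, hY']; abel
    | base c w =>
      have := base_plus β α c w x v
      rw [mul_comm, this, add_comm]
      congr 2 <;> rw [mul_comm]
    | plus y w =>
      simp only [freeOp_plusIncl_tmul, Algebra.TensorProduct.tmul_mul_tmul,
        toShuffle_mul, mul_one, one_mul, shuffle_cons_cons, map_add, TensorProduct.tmul_add]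

/-! ### The universal property of `Sh(A, B)` -/

section Universal

variable {R : Type*} [CommRing R] [Algebra k R] (Q : Ω → R →ₗ[k] R) (h : A ⊗[k] B →ₐ[k] R)

variable (ε) in
/-- The bilinear map `(ω ⊗ x, r) ↦ Q_ω(h(x) r)`. -/
def letterOp : Letter Ω A ε →ₗ[k] R →ₗ[k] R :=
  TensorProduct.lift
    ((LinearMap.llcomp k R R R).compl₂
      (LinearMap.mul k R ∘ₗ h.toLinearMap ∘ₗ plusIncl ε) ∘ₗ Finsupp.linearCombination k Q)

theorem letterOp_letter (ω : Ω) (x : A ⊗[k] augIdeal ε) (r : R) :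
    letterOp ε Q h (letter ω x) r = Q ω (h (plusIncl ε x) * r) := by
  simp [letterOp, letter]

variable (ε) in
/-- The linear map on words with `1 ↦ 1` and `(ω ⊗ x) ⊗ w ↦ Q_ω(h(x) g(w))`. -/
def wordLift : TensorAlgebra k (Letter Ω A ε) →ₗ[k] R := tensorRec 1 0 (letterOp ε Q h)

theorem wordLift_one : wordLift ε Q h 1 = 1 := tensorRec_one _ _ _

theorem wordLift_cons (ω : Ω) (x : A ⊗[k] augIdeal ε) (w : TensorAlgebra k (Letter Ω A ε)) :
    wordLift ε Q h (cons (letter ω x) w) = Q ω (h (plusIncl ε x) * wordLift ε Q h w) := by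
  simp [wordLift, tensorRec_cons, letterOp_letter]

variable {Q}

/-- For two nonempty words the shuffle recursion evaluates to the Rota-Baxter identity for `Q` at
`h(x) g(v)` and `h(y) g(w)`, with `g` the evaluation of words. -/
theorem wordLift_shuffle (hQ : IsMRBA Q) (v w : TensorAlgebra k (Letter Ω A ε)) :
    wordLift ε Q h (shuffle v w) = wordLift ε Q h v * wordLift ε Q h w := by
  induction v using word_induction generalizing w with
  | one => rw [shuffle_one_left, wordLift_one, one_mul]
  | cons_mem α x v hv =>
    induction w using word_induction with
    | one => rw [shuffle_one_right, wordLift_one, mul_one]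
    | cons_mem β y w hw =>
      rw [shuffle_cons_cons, map_add, wordLift_cons, wordLift_cons, hv, hw, wordLift_cons,
        wordLift_cons, hQ, mul_assoc, mul_left_comm (h (plusIncl ε y))]
    | add x y hx hy => simp only [map_add, mul_add, hx, hy]
    | smul r x hx => simp only [map_smul, mul_smul_comm, hx]
  | add x y hx hy => simp only [map_add, LinearMap.add_apply, add_mul, hx, hy]
  | smul r x hx => simp only [map_smul, LinearMap.smul_apply, smul_mul_assoc, hx]

variable (ε) in
/-- The algebra homomorphism on words induced by a matching Rota-Baxter algebra. -/
def shuffleLift (hQ : IsMRBA Q) : ShuffleAlgebra k (Letter Ω A ε) →ₐ[k] R :=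
  AlgHom.ofLinearMap (wordLift ε Q h ∘ₗ toShuffle.symm.toLinearMap) (wordLift_one Q h)
    (fun v w => wordLift_shuffle h hQ (toShuffle.symm v) (toShuffle.symm w))

variable (ε) in
/-- The algebra homomorphism `u ⊗ w ↦ h(u) g(w)` on `Sh(A, B)`. -/
def shLift (hQ : IsMRBA Q) : Sh Ω A ε →ₐ[k] R :=
  Algebra.TensorProduct.lift h (shuffleLift ε h hQ) (fun _ _ => Commute.all _ _)

theorem shLift_tmul (hQ : IsMRBA Q) (u : A ⊗[k] B) (w : TensorAlgebra k (Letter Ω A ε)) :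
    shLift ε h hQ (u ⊗ₜ[k] toShuffle w) = h u * wordLift ε Q h w := by
  rw [shLift, Algebra.TensorProduct.lift_tmul]
  rfl

/-- For a coefficient in `A ⊗ B⁺` this is how words are evaluated. For a coefficient `a` in `A` and
a nonempty word of value `Q_β(r)`, it is the Rota-Baxter identity solved for `Q_ω(h(a) Q_β(r))`,
with `Q_ω(h(a))` replaced by `h(φ_ω(a))`. -/
theorem isMRBAHom_shLift {φ : Ω → A →ₗ[k] A} (hQ : IsMRBA Q)
    (hφ : ∀ ω a, h (φ ω a ⊗ₜ[k] 1) = Q ω (h (a ⊗ₜ[k] 1))) :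
    IsMRBAHom (freeOp φ ε) Q (shLift ε h hQ) := by
  intro ω X
  induction X using sh_induction with
  | add X Y hX hY => simp only [map_add, hX, hY]
  | plus x w =>
    rw [freeOp_plusIncl_tmul, shLift_tmul, shLift_tmul, map_one, one_mul, wordLift_cons]
  | base a w =>
    rw [freeOp_base_tmul, map_sub, shLift_tmul, shLift_tmul, shLift_tmul, map_one, one_mul]
    induction w using word_induction with
    | one => simp [wordLift_one, headAct_one, hφ]
    | cons_mem β x w _ =>
      rw [headAct_cons, letterAct_letter, wordLift_cons, wordLift_cons, hφ, hQ,
        ← base_mul_plusIncl, map_mul h, hφ, mul_assoc, add_sub_cancel_right]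
    | add v w hv hw => simp only [map_add, mul_add, ← hv, ← hw]; abel
    | smul r v hv => simp only [map_smul, mul_smul_comm, ← hv, smul_sub]

/-- `A` and `B` generate `A ⊗ B`, and a word `(ω ⊗ x) ⊗ w` is the value of `P_{F,ω}` at `x ⊗ w`; so
induction on words shows that `A`, `B` and the operators generate everything. -/
theorem algHom_ext_of_isMRBAHom {φ : Ω → A →ₗ[k] A} {g g' : Sh Ω A ε →ₐ[k] R}
    (hg : IsMRBAHom (freeOp φ ε) Q g) (hg' : IsMRBAHom (freeOp φ ε) Q g')
    (hj : g.comp (inclA ε) = g'.comp (inclA ε)) (hi : g.comp (inclB ε) = g'.comp (inclB ε)) :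
    g = g' := by
  have hu : ∀ u : A ⊗[k] B, g (u ⊗ₜ[k] 1) = g' (u ⊗ₜ[k] 1) := by
    have : g.comp Algebra.TensorProduct.includeLeft =
        g'.comp Algebra.TensorProduct.includeLeft := by
      ext x
      · exact DFunLike.congr_fun hj x
      · exact DFunLike.congr_fun hi x
    exact fun u => DFunLike.congr_fun this u
  have split : ∀ (u : A ⊗[k] B) (w : TensorAlgebra k (Letter Ω A ε)),
      (u ⊗ₜ[k] toShuffle w : Sh Ω A ε) = (u ⊗ₜ[k] 1) * (1 ⊗ₜ[k] toShuffle w) := by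
    intro u w
    rw [Algebra.TensorProduct.tmul_mul_tmul, mul_one, one_mul]
  have hw : ∀ w : TensorAlgebra k (Letter Ω A ε),
      g (1 ⊗ₜ[k] toShuffle w) = g' (1 ⊗ₜ[k] toShuffle w) := by
    intro w
    induction w using word_induction with
    | one => exact hu 1
    | cons_mem ω x w h =>
      rw [← freeOp_plusIncl_tmul φ, hg, hg', split, map_mul g, map_mul g', hu, h]
    | add v w hv hw => simp only [map_add, TensorProduct.tmul_add, hv, hw]
    | smul r v hv => simp only [map_smul, TensorProduct.tmul_smul, hv]
  apply AlgHom.ext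
  intro X
  induction X using sh_induction with
  | add X Y hX hY => rw [map_add, map_add, hX, hY]
  | base a w => rw [split, map_mul, map_mul, hu, hw]
  | plus x w => rw [split, map_mul, map_mul, hu, hw]

end Universal

theorem isFreeMRBA_freeOp {φ : Ω → A →ₗ[k] A} (hφ : IsMRBA φ) :
    IsFreeMRBA.{w} φ (freeOp φ ε) (inclA ε) (inclB ε) where
  isRel := ⟨isMRBA_freeOp hφ, fun ω x => by
    -- On the empty word the first-letter action vanishes, so the operator restricts to `φ_ω` on
    -- `A`.
    have := freeOp_base_tmul (ε := ε) φ ω x 1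
    rw [headAct_one, map_zero, TensorProduct.tmul_zero, sub_zero] at this
    exact this.symm⟩
  universal R _ _ Q jR hR f := by
    set h : A ⊗[k] B →ₐ[k] R := Algebra.TensorProduct.lift jR f (fun _ _ => Commute.all _ _)
    have hj : jR = (shLift ε h hR.isMRBA).comp (inclA ε) := by
      ext x; simp [h, shLift, inclA]
    have hi : f = (shLift ε h hR.isMRBA).comp (inclB ε) := by
      ext x; simp [h, shLift, inclB]
    have hop : IsMRBAHom (freeOp φ ε) Q (shLift ε h hR.isMRBA) :=
      isMRBAHom_shLift h hR.isMRBA fun ω a => by simpa [h] using hR.isHom ω a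
    exact ⟨_, ⟨hop, hj, hi⟩, fun g' ⟨hg', hj', hi'⟩ =>
      algHom_ext_of_isMRBAHom hg' hop (hj'.symm.trans hj) (hi'.symm.trans hi)⟩

/-! ### The twisted operators on pure tensors -/

variable (ρ : Ω → A →ₗ[k] A) (a : Ω → Aˣ)

theorem freeTwist_coe (ω : Ω) :
    (freeTwist a ε ω : Sh Ω A ε) = pure ((a ω : A) ⊗ₜ[k] 1) [] := rfl

theorem freeTwist_inv_coe (ω : Ω) :
    (((freeTwist a ε ω)⁻¹ : (Sh Ω A ε)ˣ) : Sh Ω A ε) = pure ((((a ω)⁻¹ : Aˣ) : A) ⊗ₜ[k] 1) [] :=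
  rfl

/-- The twists have empty word part, so multiplying by them changes only the zeroth tensor factor.
Hence in the explicit formulas the outer `a_ω` cancels `a_ω⁻¹` in the coefficient `a_ω⁻¹ ρ_ω(b)`,
but not inside the first letter. -/
theorem freeTwistedOp_apply (ω : Ω) (u : A ⊗[k] B) (l : List (Ω × (A ⊗[k] augIdeal ε))) :
    freeTwistedOp ρ a ε ω (pure u l) =
      pure ((a ω : A) ⊗ₜ[k] 1) [] *
        freeOp (untwist ρ a) ε ω (pure (((((a ω)⁻¹ : Aˣ) : A) ⊗ₜ[k] 1) * u) l) := by
  rw [freeTwistedOp, twistOp_apply, freeTwist_coe, freeTwist_inv_coe, pure_nil_mul]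

theorem freeTwistedOp_base_nil (ω : Ω) (b : A) :
    freeTwistedOp ρ a ε ω (pure (b ⊗ₜ[k] 1) []) = pure (ρ ω b ⊗ₜ[k] 1) [] := by
  simp [freeTwistedOp_apply, freeOp_base_nil, pure_nil_mul, untwist_apply]

theorem freeTwistedOp_base_cons (ω ω₁ : Ω) (b : A) (u₁ : A ⊗[k] augIdeal ε)
    (l : List (Ω × (A ⊗[k] augIdeal ε))) :
    freeTwistedOp ρ a ε ω (pure (b ⊗ₜ[k] 1) ((ω₁, u₁) :: l)) =
      pure (ρ ω b ⊗ₜ[k] 1) ((ω₁, u₁) :: l) -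
        pure ((a ω : A) ⊗ₜ[k] 1) ((ω₁, (((a ω)⁻¹ : Aˣ) * ρ ω b : A) • u₁) :: l) := by
  simp [freeTwistedOp_apply, freeOp_base_cons, mul_sub, pure_nil_mul, untwist_apply]

theorem freeTwistedOp_plus (ω : Ω) (u₀ : A ⊗[k] augIdeal ε)
    (l : List (Ω × (A ⊗[k] augIdeal ε))) :
    freeTwistedOp ρ a ε ω (pure (plusIncl ε u₀) l) =
      pure ((a ω : A) ⊗ₜ[k] 1) ((ω, (((a ω)⁻¹ : Aˣ) : A) • u₀) :: l) := by
  rw [freeTwistedOp_apply, base_mul_plusIncl, freeOp_plus, pure_nil_mul, mul_one]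

end FreeObject

end MTRBA

end

/-! ### The free twisted and untwisted objects. -/

theorem mainTheorem3 {k Ω A B : Type*} [Field k] [CharZero k] [Nonempty Ω]
    [CommRing A] [Algebra k A] [CommRing B] [Algebra k B] (ε : B →ₐ[k] k)
    (ρ : Ω → A →ₗ[k] A) (a : Ω → Aˣ) (hA : MTRBA.IsMTRBA ρ a) :
    -- `Sh(A, B)` with the twisted operators is the free `(A, ρ_Ω, a_Ω)`-MTRBA over `B`
    MTRBA.IsFreeMTRBA.{w} ρ a (MTRBA.freeTwistedOp ρ a ε) (MTRBA.freeTwist a ε)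
      (MTRBA.inclA ε) (MTRBA.inclB ε) ∧
    -- explicit formulas for the twisted operators on pure tensors
    (∀ (ω : Ω) (b : A),
      MTRBA.freeTwistedOp ρ a ε ω (MTRBA.pure (b ⊗ₜ[k] 1) []) =
        MTRBA.pure (ρ ω b ⊗ₜ[k] 1) []) ∧
    (∀ (ω ω₁ : Ω) (b : A) (u₁ : A ⊗[k] MTRBA.augIdeal ε)
      (l : List (Ω × (A ⊗[k] MTRBA.augIdeal ε))),
      MTRBA.freeTwistedOp ρ a ε ω (MTRBA.pure (b ⊗ₜ[k] 1) ((ω₁, u₁) :: l)) =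
        MTRBA.pure (ρ ω b ⊗ₜ[k] 1) ((ω₁, u₁) :: l) -
          MTRBA.pure ((a ω : A) ⊗ₜ[k] 1)
            ((ω₁, (((a ω)⁻¹ : Aˣ) * ρ ω b : A) • u₁) :: l)) ∧
    (∀ (ω : Ω) (u₀ : A ⊗[k] MTRBA.augIdeal ε) (l : List (Ω × (A ⊗[k] MTRBA.augIdeal ε))),
      MTRBA.freeTwistedOp ρ a ε ω (MTRBA.pure (MTRBA.plusIncl ε u₀) l) =
        MTRBA.pure ((a ω : A) ⊗ₜ[k] 1) ((ω, (((a ω)⁻¹ : Aˣ) : A) • u₀) :: l)) ∧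
    -- the untwisted operators make `Sh(A, B)` the free MRBA from which it is obtained
    MTRBA.IsMRBA (MTRBA.untwist ρ a) ∧
    MTRBA.IsFreeMRBA.{w} (MTRBA.untwist ρ a) (MTRBA.freeOp (MTRBA.untwist ρ a) ε)
      (MTRBA.inclA ε) (MTRBA.inclB ε) := by
  have hφ := MTRBA.isMTRBA_iff_isMRBA_untwist.1 hA
  have hfree := MTRBA.isFreeMRBA_freeOp.{w} (ε := ε) hφ
  exact ⟨hfree.isFreeMTRBA fun _ => rfl, MTRBA.freeTwistedOp_base_nil ρ a,
    MTRBA.freeTwistedOp_base_cons ρ a, MTRBA.freeTwistedOp_plus ρ a, hφ, hfree⟩
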